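/- Let $A$ be a set of letters, $\mathbb{Q}\langle A\rangle$ the free associative algebra with the words in $A$ as basis, and $L(A)\subseteq\mathbb{Q}\langle A\rangle$ the free Lie algebra, i.e. the Lie subalgebra generated by the letters under $[P,Q]=PQ-QP$. The group algebra $\mathbb{Q}[S_n]$ acts on the right on the homogeneous polynomials of degree $n$ by $(w_1\cdots w_n)\sigma=w_{\sigma(1)}\cdots w_{\sigma(n)}$. For a composition $\nu=[\nu_1,\dots,\nu_m]$ of $n$ (a list of positive integers with sum $n$) let $B_\nu\in\mathbb{Q}[S_n]$ be the sum of the minimal length left coset representatives of the parabolic subgroup of $S_n$ generated by the adjacent transpositions $s_i=(i,i+1)$, $1\le i<n$, with $i\notin\{\nu_1,\nu_1+\nu_2,\dots,\nu_1+\cdots+\nu_{m-1}\}$. Proposition. Let $\kappa=[\kappa_1,\dots,\kappa_k]$ and $\nu=[\nu_1,\dots,\nu_m]$ be compositions of $n$, let $P_j\in L(A)$ be homogeneous of degree $\kappa_j$ for $j=1,\dots,k$, and let $P^{(\kappa)}=P_1P_2\cdots P_k$ (an $S_n$-Lie monomial of type $\kappa$). Then $$P^{(\kappa)}B_\nu=\sum_{\boldsymbol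 z}P^{(r(\boldsymbol z))},$$ where the sum is over all $m\times k$ matrices $\boldsymbol z=(z_{ij})$ with non-negative integer entries such that 1. $\sum_i z_{ij}=\kappa_j$ for all $j$, 2. $\sum_j z_{ij}=\nu_i$ for all $i$, 3. there is exactly one non-zero entry in each column. Here $r(\boldsymbol z)$ is the composition of $n$ obtained by reading the non-zero entries of $\boldsymbol z$ by row, and $P^{(r(\boldsymbol z))}$ is the product of the $P_j$ with one factor $P_j$ for each non-zero entry $z_{ij}$, in the order in which these entries are read; it is an $S_n$-Lie monomial of type $r(\boldsymbol z)$. Moreover $P^{(\kappa)}B_\nu=0$ unless the components of $\kappa$ can be re-ordered in such a way that sums of adjacent components give the components of $\nu$ (that is, the re-ordered list can be cut into consecutive segments with sums $\nu_1,\dots,\nu_m$). -/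

import Mathlib

noncomputable section

namespace DescentAlgebra

/-! ### Coxeter length and minimal coset representatives -/

/-- The length of `g` with respect to a set `S` of generators: the least number of factors in an
expression of `g` as a product of elements of `S`. -/
def wordLength {G : Type*} [Group G] (S : Set G) (g : G) : ℕ :=
  sInf {k | ∃ l : List G, (∀ s ∈ l, s ∈ S) ∧ l.prod = g ∧ l.length = k}

/-- `X_J`: the elements `x` of minimal length in their left coset `x W_J`, where `W_J` is the
subgroup generated by `J`. -/
def minLeftCosetReps {G : Type*} [Group G] (S J : Set G) : Set G :=
  {x | ∀ w ∈ Subgroup.closure J, wordLength S x ≤ wordLength S (x * w)}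

/-! ### The symmetric group, its Coxeter generators and the elements `B_ν` -/

/-- The Coxeter generator of the symmetric group on `Fin n` that exchanges the neighbours
`i` and `i + 1` (in the usual numbering of the points by `1, …, n`, this is `s_{i+1}`). -/
def simpleRefl (n : ℕ) (i : Fin (n - 1)) : Equiv.Perm (Fin n) :=
  Equiv.swap ⟨i, by omega⟩ ⟨i + 1, by omega⟩

/-- The set `S = {s_1, …, s_{n-1}}`. -/
def simpleSet (n : ℕ) : Set (Equiv.Perm (Fin n)) := Set.range (simpleRefl n)

/-- The subset `{s_{ν_1}, s_{ν_1+ν_2}, …, s_{ν_1+⋯+ν_{k-1}}}` of `S` corresponding to the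
composition `ν = [ν_1, …, ν_k]` of `n`. -/
def simpleSubset {n : ℕ} (ν : Composition n) : Set (Equiv.Perm (Fin n)) :=
  {s | ∃ i : Fin (n - 1), s = simpleRefl n i ∧ ∃ k, ν.sizeUpTo k = (i : ℕ) + 1}

open Classical in
/-- `B_ν`, an element of the group algebra of the symmetric group: the formal sum of the minimal
length left coset representatives of `W_K`, where `K` is the complement in `S` of the subset
corresponding to `ν`. -/
def descentBasis {n : ℕ} (ν : Composition n) : MonoidAlgebra ℚ (Equiv.Perm (Fin n)) :=
  ∑ σ : Equiv.Perm (Fin n) with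
      σ ∈ minLeftCosetReps (simpleSet n) (simpleSet n \ simpleSubset ν),
    MonoidAlgebra.single σ 1

/-! ### Noncommutative polynomials, Lie polynomials and the place action -/

/-- The free associative algebra `ℚ⟨A⟩`, with the words in the letters `A` as a basis. -/
abbrev NCPoly (A : Type*) := MonoidAlgebra ℚ (FreeMonoid A)

attribute [local instance] LieRing.ofAssociativeRing

/-- The free Lie algebra `L(A)`, as the Lie subalgebra of `ℚ⟨A⟩` (with bracket
`[P, Q] = P Q - Q P`) generated by the letters. -/
def freeLie (A : Type*) : LieSubalgebra ℚ (NCPoly A) :=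
  LieSubalgebra.lieSpan ℚ (NCPoly A)
    (Set.range fun a : A => (MonoidAlgebra.single (FreeMonoid.of a) (1 : ℚ) : NCPoly A))

/-- `x` is homogeneous of degree `d`: only words of length `d` occur in `x`. -/
def IsHomog {A : Type*} (d : ℕ) (x : NCPoly A) : Prop :=
  ∀ w : FreeMonoid A, x.coeff w ≠ 0 → w.length = d

/-- The right action of a permutation of the `n` places on a word:
`(w_1 ⋯ w_n) · σ = w_{σ(1)} ⋯ w_{σ(n)}`. Words of length different from `n` are sent to `0`. -/
def wordAct {A : Type*} (n : ℕ) (w : FreeMonoid A) (σ : Equiv.Perm (Fin n)) : NCPoly A :=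
  if h : w.toList.length = n then
    MonoidAlgebra.single
      (FreeMonoid.ofList (List.ofFn fun i : Fin n => w.toList.get ((σ i).cast h.symm))) 1
  else 0

/-- The right action `x · f` of the group algebra `ℚ[S_n]` on noncommutative polynomials,
the bilinear extension of `wordAct`. -/
def polyAct {A : Type*} {n : ℕ} (x : NCPoly A) (f : MonoidAlgebra ℚ (Equiv.Perm (Fin n))) :
    NCPoly A :=
  x.coeff.sum fun w a => f.coeff.sum fun σ b => (a * b) • wordAct n w σ

/-- `P_1, …, P_k` are homogeneous Lie polynomials whose degrees are the components of `κ`. -/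
def IsLieFamily {A : Type*} {n : ℕ} (κ : Composition n) (P : Fin κ.length → NCPoly A) : Prop :=
  ∀ j, P j ∈ freeLie A ∧ IsHomog (κ.blocksFun j) (P j)

/-- `x` is an `S_n`-Lie monomial of type `κ`: a concatenation product `P_1 ⋯ P_k` of homogeneous
Lie polynomials whose degrees are the components of `κ`. -/
def IsLieMonomial {A : Type*} {n : ℕ} (κ : Composition n) (x : NCPoly A) : Prop :=
  ∃ P : Fin κ.length → NCPoly A, IsLieFamily κ P ∧ x = (List.ofFn P).prod

/-! ### The matrices -/

/-- The positions of the nonzero entries of a matrix, read by row: from left to right within a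
row, and the rows from top to bottom. -/
def nonzeroCells {k l : ℕ} (z : Matrix (Fin k) (Fin l) ℕ) : List (Fin k × Fin l) :=
  (List.finRange k).flatMap fun i =>
    ((List.finRange l).filter fun j => z i j ≠ 0).map fun j => (i, j)

/-- `r(z)`: the nonzero entries of `z`, read by row. -/
def rowReading {k l : ℕ} (z : Matrix (Fin k) (Fin l) ℕ) : List ℕ :=
  (nonzeroCells z).map fun c => z c.1 c.2

/-- `P^{(r(z))}`: the concatenation product of the `P_j`, one factor `P_j` for each nonzero entry
`z_{ij}`, in the order in which these entries are read by row. -/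
def rowProduct {A : Type*} {k l : ℕ} (P : Fin l → NCPoly A) (z : Matrix (Fin k) (Fin l) ℕ) :
    NCPoly A :=
  ((nonzeroCells z).map fun c => P c.2).prod

/-- The matrices with nonnegative integer entries, column sums `κ`, row sums `ν`, and exactly one
nonzero entry in each column. -/
def actionMatrices {n : ℕ} (κ ν : Composition n) :
    Set (Matrix (Fin ν.length) (Fin κ.length) ℕ) :=
  {z | (∀ j, ∑ i, z i j = κ.blocksFun j) ∧ (∀ i, ∑ j, z i j = ν.blocksFun i) ∧
    ∀ j, ∃! i, z i j ≠ 0}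

theorem actionMatrices_finite {n : ℕ} (κ ν : Composition n) : (actionMatrices κ ν).Finite := by
  have h : (Set.Iic (fun (_ : Fin ν.length) (j : Fin κ.length) => κ.blocksFun j)).Finite :=
    Set.finite_Iic _
  refine h.subset fun z hz i j => ?_
  change z i j ≤ κ.blocksFun j
  rw [← hz.1 j]
  exact Finset.single_le_sum (f := fun i => z i j) (fun _ _ => Nat.zero_le _) (Finset.mem_univ i)

/-- Sums of adjacent members of the list `l` give the members of `m`, in order: `l` can be cut
into consecutive segments whose sums are the members of `m`. -/
def AdjacentSums (l m : List ℕ) : Prop :=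
  ∃ L : List (List ℕ), L.flatten = l ∧ L.map List.sum = m

end DescentAlgebra

end

/-!
The element `B_ν` acts on a polynomial `x` by multiplying out the part of multidegree `ν` of the
iterated unshuffle coproduct of `x`. Indeed, by the exchange condition, the minimal coset
representatives are the permutations that increase on each block of `ν`; such a permutation `σ` is
the stable sort of the map `f` that sends the place `σ p` to the block containing `p`, and `f` runs
through all ways to distribute the letters of a word over the blocks, with `ν_i` letters in block
`i`.

Lie polynomials are primitive, so in the coproduct of `P_1 ⋯ P_k` each factor `P_j` goes entirely
into one tensor factor `f j`. The terms of multidegree `ν` are those for which the degrees `κ_j`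
with `f j = i` add up to `ν_i`, that is, those for which the matrix with entries `κ_j` at the
positions `(f j, j)` has row sums `ν`; multiplying out, the `P_j` appear in the order of the
stable sort of `f`, which is the row reading of that matrix.
-/

noncomputable section

namespace DescentAlgebra

attribute [local instance] LieRing.ofAssociativeRing

/-! ### Sorting and fibres -/

section Sorting

variable {k : ℕ} {α : Type*} [LinearOrder α]

theorem flatMap_filter_eq_ofFn_sort {m : ℕ} (f : Fin k → Fin m) :
    ((List.finRange m).flatMap fun i => (List.finRange k).filter fun j => f j = i) =
      List.ofFn (Tuple.sort f) := by
  refine List.Pairwise.eq_of_mem_iff (r := (fun j => toLex (f j, j)) ⁻¹'o (· < ·))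
    (List.pairwise_flatMap.mpr ⟨fun i _ => ?_, ?_⟩) (List.pairwise_ofFn.mpr fun i j hij => ?_)
    (by simpa [List.mem_ofFn] using fun j => (Tuple.sort f).surjective j)
  · exact ((List.pairwise_lt_finRange k).filter _).imp_of_mem fun ha hb hab =>
      Prod.Lex.toLex_lt_toLex.mpr (Or.inr ⟨by simp_all, hab⟩)
  · exact (List.pairwise_lt_finRange m).imp fun hii' a ha b hb =>
      Prod.Lex.toLex_lt_toLex.mpr (Or.inl (by simp_all))
  · obtain ⟨hmono, hties⟩ := Tuple.eq_sort_iff.mp (rfl : Tuple.sort f = Tuple.sort f)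
    exact Prod.Lex.toLex_lt_toLex.mpr
      ((hmono hij.le).lt_or_eq.imp_right fun h => ⟨h, hties i j hij h⟩)

theorem comp_sort_eq_of_card_fiber_eq {f g : Fin k → α} (hg : Monotone g)
    (hfg : ∀ a, Fintype.card {j // g j = a} = Fintype.card {j // f j = a}) :
    f ∘ Tuple.sort f = g := by
  let τ : Equiv.Perm (Fin k) := Equiv.ofFiberEquiv fun a => Fintype.equivOfCardEq (hfg a)
  have hτ : f ∘ τ = g := funext fun j => Equiv.ofFiberEquiv_map _ j
  rw [← Tuple.comp_sort_eq_comp_iff_monotone.mpr (hτ ▸ hg), hτ]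

end Sorting

section FiberSum

variable {ι κ M : Type*} [Fintype κ] [DecidableEq ι] [AddCommMonoid M]

/-- The push-forward of the family `e` along `f`: the sums of `e` over the fibres of `f`. -/
def fiberSum (e : κ → M) (f : κ → ι) : ι → M :=
  fun i => ∑ j with f j = i, e j

theorem fiberSum_eq_sum_single (e : κ → M) (f : κ → ι) :
    fiberSum e f = ∑ j, Pi.single (f j) (e j) := by
  ext i
  simp [fiberSum, Finset.sum_filter, Finset.sum_apply, Pi.single_apply, eq_comm]

theorem sum_fiberSum [Fintype ι] (e : κ → M) (f : κ → ι) : ∑ i, fiberSum e f i = ∑ j, e j :=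
  Finset.sum_fiberwise _ _ _

theorem fiberSum_one (f : κ → ι) (i : ι) :
    fiberSum (1 : κ → ℕ) f i = Fintype.card {j // f j = i} := by
  simp [fiberSum, Fintype.card_subtype]

theorem fiberSum_comp_equiv (e : κ → M) (f : κ → ι) (σ : Equiv.Perm κ) :
    fiberSum (e ∘ σ) (f ∘ σ) = fiberSum e f := by
  ext i
  simpa [fiberSum, Finset.sum_filter] using Equiv.sum_comp σ fun j => if f j = i then e j else 0

end FiberSum

/-! ### Words in the Coxeter generators -/

section CosetRepresentatives

variable {G : Type*} [Group G]

theorem wordLength_prod_le {S : Set G} {l : List G} (hl : ∀ s ∈ l, s ∈ S) :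
    wordLength S l.prod ≤ l.length :=
  Nat.sInf_le ⟨l, hl, rfl, rfl⟩

theorem exists_list_length_eq_wordLength {S : Set G} {g : G} (hg : g ∈ Submonoid.closure S) :
    ∃ l : List G, (∀ s ∈ l, s ∈ S) ∧ l.prod = g ∧ l.length = wordLength S g := by
  obtain ⟨l, hl, hprod⟩ := Submonoid.exists_list_of_mem_closure hg
  exact Nat.sInf_mem (s := {k | ∃ l : List G, (∀ s ∈ l, s ∈ S) ∧ l.prod = g ∧ l.length = k})
    ⟨l.length, l, hl, hprod, rfl⟩

theorem exists_mul_mem_minLeftCosetReps (S J : Set G) (g : G) :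
    ∃ w ∈ Subgroup.closure J, g * w ∈ minLeftCosetReps S J := by
  obtain ⟨w, hw, hmin⟩ := WellFounded.has_min
    (measure fun w => wordLength S (g * w)).wf (Subgroup.closure J : Set G) ⟨1, one_mem _⟩
  refine ⟨w, hw, fun v hv => ?_⟩
  rw [mul_assoc]
  exact not_lt.mp (hmin (w * v) (mul_mem hw hv))

end CosetRepresentatives

section SymmetricGroup

variable {n : ℕ}

theorem simpleRefl_val (i : Fin (n - 1)) (p : Fin n) :
    (simpleRefl n i p : ℕ) =
      if (p : ℕ) = i then (i : ℕ) + 1 else if (p : ℕ) = i + 1 then (i : ℕ) else p := by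
  simp only [simpleRefl, Equiv.swap_apply_def, Fin.ext_iff]
  split_ifs <;> rfl

theorem simpleRefl_injective (n : ℕ) : Function.Injective (simpleRefl n) := by
  intro i j hij
  have h := congrArg Fin.val (Equiv.congr_fun hij ⟨i, by omega⟩)
  simp only [simpleRefl_val, if_true] at h
  ext
  split_ifs at h <;> omega

theorem simpleRefl_eq_swap_of_lt {i : Fin (n - 1)} {p q : Fin n} (hpq : p < q)
    (h : simpleRefl n i q < simpleRefl n i p) : simpleRefl n i = Equiv.swap p q := by
  simp only [Fin.lt_def, simpleRefl_val] at hpq h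
  obtain ⟨hp, hq⟩ : (p : ℕ) = i ∧ (q : ℕ) = i + 1 := by split_ifs at h <;> omega
  rw [simpleRefl]
  congr 1 <;> ext <;> simp [hp, hq]

theorem closure_simpleSet (n : ℕ) : Submonoid.closure (simpleSet n) = ⊤ := by
  cases n with
  | zero => exact Subsingleton.elim _ _
  | succ n => exact Equiv.Perm.mclosure_swap_castSucc_succ n

/-- The exchange condition: the deleted letter is the one that puts the images of `i` and `i + 1`
in the wrong order. -/
theorem exists_list_prod_eq_mul_simpleRefl {i : Fin (n - 1)} {l : List (Equiv.Perm (Fin n))}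
    (hl : ∀ s ∈ l, s ∈ simpleSet n) (hdesc : l.prod ⟨i + 1, by omega⟩ < l.prod ⟨i, by omega⟩) :
    ∃ l' : List (Equiv.Perm (Fin n)), (∀ s ∈ l', s ∈ simpleSet n) ∧
      l'.prod = l.prod * simpleRefl n i ∧ l'.length + 1 = l.length := by
  induction l with
  | nil => simp [Fin.lt_def] at hdesc
  | cons s l ih =>
    obtain ⟨⟨j, rfl⟩, hl₁⟩ := List.forall_mem_cons.mp hl
    rw [List.prod_cons] at hdesc ⊢
    rcases lt_or_gt_of_ne (l.prod.injective.ne (a₁ := ⟨i, by omega⟩) (a₂ := ⟨i + 1, by omega⟩)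
      (by simp)) with hasc | hdesc'
    · refine ⟨l, hl₁, ?_, rfl⟩
      rw [simpleRefl_eq_swap_of_lt hasc hdesc, Equiv.swap_apply_apply, simpleRefl]
      simp [mul_assoc]
    · obtain ⟨l', hl', hprod, hlen⟩ := ih hl₁ hdesc'
      exact ⟨simpleRefl n j :: l', List.forall_mem_cons.mpr ⟨⟨j, rfl⟩, hl'⟩,
        by rw [List.prod_cons, hprod, mul_assoc], by simp [hlen]⟩

theorem wordLength_mul_simpleRefl_lt {σ : Equiv.Perm (Fin n)} {i : Fin (n - 1)}
    (hdesc : σ ⟨i + 1, by omega⟩ < σ ⟨i, by omega⟩) :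
    wordLength (simpleSet n) (σ * simpleRefl n i) < wordLength (simpleSet n) σ := by
  have hσ : σ ∈ Submonoid.closure (simpleSet n) := closure_simpleSet n ▸ Submonoid.mem_top σ
  obtain ⟨l, hl, rfl, hlen⟩ := exists_list_length_eq_wordLength hσ
  obtain ⟨l', hl', hprod, hlen'⟩ := exists_list_prod_eq_mul_simpleRefl hl hdesc
  have := wordLength_prod_le hl'
  rw [← hprod]
  omega

end SymmetricGroup

/-! ### Minimal coset representatives of Young subgroups -/

section YoungSubgroup

variable {n : ℕ} (ν : Composition n)

theorem sizeUpTo_le_iff_le_index {k : ℕ} {j : Fin n} : ν.sizeUpTo k ≤ j ↔ k ≤ ν.index j := by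
  refine ⟨fun h => ?_, fun h => (ν.monotone_sizeUpTo h).trans (ν.sizeUpTo_index_le j)⟩
  by_contra! hlt
  exact (ν.lt_sizeUpTo_index_succ j).not_ge ((ν.monotone_sizeUpTo hlt).trans h)

theorem index_monotone : Monotone ν.index := fun i _ hij =>
  (sizeUpTo_le_iff_le_index ν).mp ((ν.sizeUpTo_index_le i).trans hij)

theorem index_eq_index_succ_iff (i : Fin (n - 1)) :
    ν.index ⟨i, by omega⟩ = ν.index ⟨i + 1, by omega⟩ ↔ ¬ ∃ k, ν.sizeUpTo k = (i : ℕ) + 1 := by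
  constructor
  · rintro h ⟨k, hk⟩
    have hle := (sizeUpTo_le_iff_le_index ν (j := ⟨i + 1, by omega⟩)).mp hk.le
    rw [← h, ← sizeUpTo_le_iff_le_index] at hle
    simp only at hle
    omega
  · intro h
    refine le_antisymm (index_monotone ν (by simp)) ?_
    have hle := ν.sizeUpTo_index_le ⟨i + 1, by omega⟩
    have hne := not_exists.mp h (ν.index ⟨i + 1, by omega⟩)
    exact (sizeUpTo_le_iff_le_index ν).mp (Nat.lt_succ_iff.mp (lt_of_le_of_ne hle hne))

theorem simpleRefl_mem_diff_iff (i : Fin (n - 1)) :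
    simpleRefl n i ∈ simpleSet n \ simpleSubset ν ↔
      ν.index ⟨i, by omega⟩ = ν.index ⟨i + 1, by omega⟩ := by
  rw [index_eq_index_succ_iff, Set.mem_sdiff, and_iff_right ⟨i, rfl⟩]
  refine not_congr ⟨?_, fun h => ⟨i, rfl, h⟩⟩
  rintro ⟨j, hj, hk⟩
  exact simpleRefl_injective n hj ▸ hk

variable {ν} in
theorem index_apply_of_mem_closure {w : Equiv.Perm (Fin n)}
    (hw : w ∈ Subgroup.closure (simpleSet n \ simpleSubset ν)) (p : Fin n) :
    ν.index (w p) = ν.index p := by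
  induction hw using Subgroup.closure_induction generalizing p with
  | mem s hs =>
    obtain ⟨i, rfl⟩ := hs.1
    have h := (simpleRefl_mem_diff_iff ν i).mp hs
    rw [simpleRefl, Equiv.swap_apply_def]
    split_ifs with hp hp <;> simp [hp, h]
  | one => rfl
  | mul x y _ _ hx hy => rw [Equiv.Perm.mul_apply, hx, hy]
  | inv x _ hx => simpa using (hx (x⁻¹ p)).symm

theorem sort_index_comp_symm_eq_iff {σ : Equiv.Perm (Fin n)} :
    Tuple.sort (ν.index ∘ σ.symm) = σ ↔
      ∀ i j, i < j → ν.index i = ν.index j → σ i < σ j := by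
  rw [eq_comm, Tuple.eq_sort_iff]
  simp [Function.comp_assoc, index_monotone ν]

theorem apply_lt_apply_of_index_eq {α : Type*} [Preorder α] {f : Fin n → α}
    (hf : ∀ i : Fin (n - 1), ν.index ⟨i, by omega⟩ = ν.index ⟨i + 1, by omega⟩ →
      f ⟨i, by omega⟩ < f ⟨i + 1, by omega⟩)
    {i j : Fin n} (hij : i < j) (hν : ν.index i = ν.index j) : f i < f j := by
  obtain ⟨i, hi⟩ := i
  obtain ⟨j, hj⟩ := j
  rw [Fin.mk_lt_mk] at hij
  induction j, (hij : i + 1 ≤ j) using Nat.le_induction with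
  | base => exact hf ⟨i, by omega⟩ hν
  | succ k hk ih =>
    have hik : ν.index ⟨i, hi⟩ ≤ ν.index ⟨k, by omega⟩ :=
      index_monotone ν (Fin.mk_le_mk.mpr (by omega))
    have hkk : ν.index ⟨k, by omega⟩ ≤ ν.index ⟨k + 1, hj⟩ :=
      index_monotone ν (Fin.mk_le_mk.mpr (by omega))
    exact (ih (by omega) (le_antisymm hik (hkk.trans hν.ge))).trans
      (hf ⟨k, by omega⟩ (le_antisymm hkk (hν.ge.trans hik)))

variable {ν} in
theorem sort_index_comp_symm_of_mem_minLeftCosetReps {σ : Equiv.Perm (Fin n)}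
    (hσ : σ ∈ minLeftCosetReps (simpleSet n) (simpleSet n \ simpleSubset ν)) :
    Tuple.sort (ν.index ∘ σ.symm) = σ := by
  refine (sort_index_comp_symm_eq_iff ν).mpr fun i j hij hν => ?_
  refine apply_lt_apply_of_index_eq ν (fun i hi => ?_) hij hν
  by_contra! hle
  have hdesc : σ ⟨i + 1, by omega⟩ < σ ⟨i, by omega⟩ := hle.lt_of_ne (σ.injective.ne (by simp))
  exact (wordLength_mul_simpleRefl_lt hdesc).not_ge
    (hσ _ (Subgroup.subset_closure ((simpleRefl_mem_diff_iff ν i).mpr hi)))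

/-- A coset `σ W` determines `ν.index ∘ σ.symm`, hence at most one permutation that sorts it; so
the minimal representative, which does sort it, is this permutation. -/
theorem mem_minLeftCosetReps_iff_sort_eq (σ : Equiv.Perm (Fin n)) :
    σ ∈ minLeftCosetReps (simpleSet n) (simpleSet n \ simpleSubset ν) ↔
      Tuple.sort (ν.index ∘ σ.symm) = σ := by
  refine ⟨sort_index_comp_symm_of_mem_minLeftCosetReps, fun hσ => ?_⟩
  obtain ⟨w, hw, hmin⟩ := exists_mul_mem_minLeftCosetReps (simpleSet n)
    (simpleSet n \ simpleSubset ν) σ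
  have hindex : ν.index ∘ (σ * w).symm = ν.index ∘ σ.symm :=
    funext fun p => index_apply_of_mem_closure (inv_mem hw) (σ.symm p)
  have hσw : σ * w = σ := by
    rw [← sort_index_comp_symm_of_mem_minLeftCosetReps hmin, hindex, hσ]
  exact hσw ▸ hmin

theorem fiberSum_one_index : fiberSum (1 : Fin n → ℕ) ν.index = ν.blocksFun := by
  ext i
  have hindex (p : Σ i : Fin ν.length, Fin (ν.blocksFun i)) :
      ν.index (ν.blocksFinEquiv p) = p.1 := ν.index_embedding p.1 p.2
  rw [fiberSum, Finset.sum_filter, ← ν.blocksFinEquiv.sum_comp, Fintype.sum_sigma]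
  simp [hindex]

variable {ν} in
theorem comp_sort_eq_index {f : Fin n → Fin ν.length} (hf : fiberSum 1 f = ν.blocksFun) :
    f ∘ Tuple.sort f = ν.index :=
  comp_sort_eq_of_card_fiber_eq (index_monotone ν) fun i => by
    rw [← fiberSum_one, ← fiberSum_one, fiberSum_one_index, hf]

end YoungSubgroup

/-! ### Tensor powers of a monoid algebra -/

section TensorPower

variable {R M ι : Type*} [CommSemiring R] [Monoid M] [DecidableEq ι]

/-- The embedding `x ↦ 1 ⊗ ⋯ ⊗ x ⊗ ⋯ ⊗ 1` of `R[M]` into the `i`-th factor of its tensor power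
indexed by `ι`, which is encoded as the monoid algebra `R[M^ι]`. -/
def slot (i : ι) : MonoidAlgebra R M →ₐ[R] MonoidAlgebra R (ι → M) :=
  MonoidAlgebra.mapDomainAlgHom R R (MonoidHom.mulSingle (fun _ => M) i)

theorem slot_single (i : ι) (w : M) (r : R) :
    slot i (MonoidAlgebra.single w r) = MonoidAlgebra.single (Pi.mulSingle i w) r := by
  simp [slot]

theorem commute_slot {i j : ι} (hij : i ≠ j) (x y : MonoidAlgebra R M) :
    Commute (slot i x) (slot j y) := by
  induction x using MonoidAlgebra.induction_linear with
  | zero => simp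
  | add x₁ x₂ h₁ h₂ => simpa only [map_add] using h₁.add_left h₂
  | single u r =>
    induction y using MonoidAlgebra.induction_linear with
    | zero => simp
    | add y₁ y₂ h₁ h₂ => simpa only [map_add] using h₁.add_right h₂
    | single v s =>
      rw [slot_single, slot_single, commute_iff_eq, MonoidAlgebra.single_mul_single,
        MonoidAlgebra.single_mul_single, mul_comm r s,
        (Pi.mulSingle_commute (f := fun _ => M) hij u v).eq]

theorem prod_ofFn_single {k : ℕ} (w : Fin k → M) :
    (List.ofFn fun j => (MonoidAlgebra.single (w j) 1 : MonoidAlgebra R M)).prod =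
      MonoidAlgebra.single (List.ofFn w).prod 1 := by
  simpa [List.map_ofFn, Function.comp_def] using
    (map_list_prod (MonoidAlgebra.of R M) (List.ofFn w)).symm

theorem prod_ofFn_mulSingle_apply {k : ℕ} (f : Fin k → ι) (w : Fin k → M) (i : ι) :
    (List.ofFn fun j => (Pi.mulSingle (f j) (w j) : ι → M)).prod i =
      (((List.finRange k).filter fun j => f j = i).map w).prod := by
  rw [← Pi.evalMonoidHom_apply (f := fun _ => M) i (List.prod _), map_list_prod, List.ofFn_eq_map,
    List.map_map]
  induction List.finRange k with
  | nil => simp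
  | cons j l ih =>
    rw [List.map_cons, List.prod_cons, ih, List.filter_cons]
    by_cases hj : f j = i
    · subst hj
      simp
    · simp [hj]

/-- The multiplication map `x_1 ⊗ ⋯ ⊗ x_m ↦ x_1 ⋯ x_m`. -/
def concat {m : ℕ} : MonoidAlgebra R (Fin m → M) →ₗ[R] MonoidAlgebra R M :=
  MonoidAlgebra.mapDomainLinearMap R R fun u => (List.ofFn u).prod

theorem concat_single {m : ℕ} (u : Fin m → M) (r : R) :
    concat (MonoidAlgebra.single u r) = MonoidAlgebra.single (List.ofFn u).prod r := by
  simp [concat]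

theorem prod_ofFn_prod_ofFn_mulSingle {k m : ℕ} (f : Fin k → Fin m) (w : Fin k → M) :
    (List.ofFn (List.ofFn fun j => (Pi.mulSingle (f j) (w j) : Fin m → M)).prod).prod =
      (List.ofFn (w ∘ Tuple.sort f)).prod := by
  rw [← List.map_ofFn, ← flatMap_filter_eq_ofFn_sort, List.map_flatMap, List.flatMap_def,
    List.prod_flatten, List.map_map, List.ofFn_eq_map]
  exact congrArg List.prod (List.map_congr_left fun i _ => prod_ofFn_mulSingle_apply f w i)

theorem concat_prod_slot {k m : ℕ} (f : Fin k → Fin m) (P : Fin k → MonoidAlgebra R M) :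
    concat (List.ofFn fun j => slot (f j) (P j)).prod = (List.ofFn (P ∘ Tuple.sort f)).prod := by
  suffices h : concat.compMultilinearMap ((MultilinearMap.mkPiAlgebraFin R k _).compLinearMap
      fun j => (slot (f j)).toLinearMap) =
      (MultilinearMap.mkPiAlgebraFin R k (MonoidAlgebra R M)).domDomCongr (Tuple.sort f) from
    DFunLike.congr_fun h P
  refine Module.Basis.ext_multilinear (fun _ => MonoidAlgebra.basis M R) fun w => ?_
  simp only [LinearMap.compMultilinearMap_apply, MultilinearMap.compLinearMap_apply,
    MultilinearMap.domDomCongr_apply, MultilinearMap.mkPiAlgebraFin_apply,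
    MonoidAlgebra.basis_apply, AlgHom.toLinearMap_apply, slot_single, prod_ofFn_single,
    concat_single, prod_ofFn_prod_ofFn_mulSingle, Function.comp_def]

end TensorPower

/-! ### The unshuffle coproduct and its primitive elements -/

section Coproduct

theorem sum_lie_sum_of_pairwise_commute {ι B : Type*} [Fintype ι] [Ring B] {x y : ι → B}
    (h : ∀ i j, i ≠ j → Commute (x i) (y j)) : ⁅∑ i, x i, ∑ j, y j⁆ = ∑ i, ⁅x i, y i⁆ := by
  classical
  rw [sum_lie_sum]
  exact Finset.sum_congr rfl fun i _ =>
    Fintype.sum_eq_single i fun j hji => (h i j hji.symm).lie_eq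

variable {R A ι : Type*} [Fintype ι] [DecidableEq ι]

section CommSemiring

variable [CommSemiring R]

/-- The iterated unshuffle coproduct of the free associative algebra, with values in the tensor
power indexed by `ι`: the algebra homomorphism for which the letters are primitive. -/
def coprod : MonoidAlgebra R (FreeMonoid A) →ₐ[R] MonoidAlgebra R (ι → FreeMonoid A) :=
  MonoidAlgebra.lift R _ _
    (FreeMonoid.lift fun a => ∑ i, slot i (MonoidAlgebra.single (FreeMonoid.of a) 1))

theorem coprod_letter (a : A) :
    coprod (MonoidAlgebra.single (FreeMonoid.of a) (1 : R)) =
      ∑ i : ι, slot i (MonoidAlgebra.single (FreeMonoid.of a) 1) := by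
  simp [coprod]

theorem coprod_prod_ofFn {k : ℕ} {P : Fin k → MonoidAlgebra R (FreeMonoid A)}
    (hP : ∀ j, coprod (P j) = ∑ i : ι, slot i (P j)) :
    coprod (List.ofFn P).prod =
      ∑ f : Fin k → ι, (List.ofFn fun j => slot (f j) (P j)).prod := by
  simp only [map_list_prod, List.map_ofFn, Function.comp_def, hP]
  simp only [← MultilinearMap.mkPiAlgebraFin_apply (R := R)]
  exact MultilinearMap.map_sum _ _

end CommSemiring

variable (R A ι) in
/-- The Lie algebra of the polynomials that are primitive for the coproduct with values in the
tensor power indexed by `ι`: those with coproduct `∑ 1 ⊗ ⋯ ⊗ x ⊗ ⋯ ⊗ 1`. -/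
def primitivePart [CommRing R] : LieSubalgebra R (MonoidAlgebra R (FreeMonoid A)) where
  carrier := {x | coprod x = ∑ i : ι, slot i x}
  add_mem' hx hy := by simp_all [Finset.sum_add_distrib]
  zero_mem' := by simp
  smul_mem' r x hx := by simp_all [Finset.smul_sum]
  lie_mem' {x y} hx hy := by
    rw [Set.mem_ofPred_eq] at hx hy ⊢
    have hcomm (i j : ι) (hij : i ≠ j) := commute_slot hij x y
    simpa only [LieRing.of_associative_ring_bracket, map_sub, map_mul, hx, hy] using
      sum_lie_sum_of_pairwise_commute hcomm

theorem freeLie_le_primitivePart : freeLie A ≤ primitivePart ℚ A ι := by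
  refine LieSubalgebra.lieSpan_le.mpr ?_
  rintro _ ⟨a, rfl⟩
  exact coprod_letter a

end Coproduct

/-! ### Multidegrees -/

section Multidegree

variable {R A ι : Type*} [CommSemiring R]

variable (R A) in
/-- The part of multidegree `d` of a tensor power of the free associative algebra, spanned by the
tuples of words of lengths `d i`. -/
def multidegreePart (d : ι → ℕ) : Submodule R (MonoidAlgebra R (ι → FreeMonoid A)) :=
  MonoidAlgebra.supported R R {u | ∀ i, (u i).length = d i}

instance gradedMonoid_multidegreePart :
    SetLike.GradedMonoid (multidegreePart R A (ι := ι)) where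
  one_mem := by
    classical
    refine MonoidAlgebra.mem_supported'.mpr fun u hu => ?_
    rw [MonoidAlgebra.one_def, MonoidAlgebra.coeff_single, Finsupp.single_apply, if_neg]
    rintro rfl
    simp at hu
  mul_mem d e x y hx hy := by
    classical
    refine MonoidAlgebra.mem_supported.mpr fun w hw => ?_
    obtain ⟨u, hu, v, hv, rfl⟩ :=
      Finset.mem_mul.mp (MonoidAlgebra.support_coeff_mul_subset x y hw)
    intro i
    simp [MonoidAlgebra.mem_supported.mp hx hu i, MonoidAlgebra.mem_supported.mp hy hv i]

/-- The projection of a tensor power of the free associative algebra onto its part of multidegree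
`d`. -/
def degProj [Fintype ι] (d : ι → ℕ) :
    MonoidAlgebra R (ι → FreeMonoid A) →ₗ[R] MonoidAlgebra R (ι → FreeMonoid A) where
  toFun x := .ofCoeff (x.coeff.filter fun u => ∀ i, (u i).length = d i)
  map_add' x y := by simp [Finsupp.filter_add]
  map_smul' r x := by simp [Finsupp.filter_smul]

theorem degProj_of_mem [Fintype ι] (d : ι → ℕ) {e : ι → ℕ} {x : MonoidAlgebra R (ι → FreeMonoid A)}
    (hx : x ∈ multidegreePart R A e) : degProj d x = if e = d then x else 0 := by
  split_ifs with h
  · subst h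
    exact congrArg MonoidAlgebra.ofCoeff (Finsupp.filter_eq_self_iff _ _ |>.mpr fun u hu =>
      MonoidAlgebra.mem_supported.mp hx (Finsupp.mem_support_iff.mpr hu))
  · refine congrArg MonoidAlgebra.ofCoeff (Finsupp.filter_eq_zero_iff _ _ |>.mpr fun u hu => ?_)
    exact MonoidAlgebra.mem_supported'.mp hx u fun hu' =>
      h (funext fun i => (hu' i).symm.trans (hu i))

variable [DecidableEq ι]

theorem slot_mem_multidegreePart {d : ℕ} {x : MonoidAlgebra R (FreeMonoid A)}
    (hx : x ∈ MonoidAlgebra.supported R R {w : FreeMonoid A | w.length = d}) (i : ι) :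
    slot i x ∈ multidegreePart R A (Pi.single i d) := by
  classical
  refine MonoidAlgebra.mem_supported.mpr fun u hu => ?_
  obtain ⟨w, hw, rfl⟩ := Finset.mem_image.mp (Finsupp.mapDomain_support hu)
  intro j
  have := hx hw
  by_cases hj : j = i
  · subst hj
    simpa using this
  · simp [hj]

theorem prod_slot_mem_multidegreePart {k : ℕ} {e : Fin k → ℕ}
    {P : Fin k → MonoidAlgebra R (FreeMonoid A)}
    (hP : ∀ j, P j ∈ MonoidAlgebra.supported R R {w : FreeMonoid A | w.length = e j})
    (f : Fin k → ι) :
    (List.ofFn fun j => slot (f j) (P j)).prod ∈ multidegreePart R A (fiberSum e f) := by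
  rw [fiberSum_eq_sum_single, ← List.sum_ofFn]
  exact SetLike.list_prod_ofFn_mem_graded _ _ fun j => slot_mem_multidegreePart (hP j) (f j)

/-- Multiplying out the coproduct of a product of primitive elements, each term places every
factor `P j` in one tensor factor `f j`. -/
theorem concat_degProj_coprod_prod_ofFn {k m : ℕ} {e : Fin k → ℕ}
    {P : Fin k → MonoidAlgebra R (FreeMonoid A)}
    (hprim : ∀ j, coprod (P j) = ∑ i : Fin m, slot i (P j))
    (hdeg : ∀ j, P j ∈ MonoidAlgebra.supported R R {w : FreeMonoid A | w.length = e j})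
    (d : Fin m → ℕ) :
    concat (degProj d (coprod (List.ofFn P).prod)) =
      ∑ f : Fin k → Fin m with fiberSum e f = d, (List.ofFn (P ∘ Tuple.sort f)).prod := by
  rw [coprod_prod_ofFn hprim, map_sum, map_sum, Finset.sum_filter]
  refine Finset.sum_congr rfl fun f _ => ?_
  rw [degProj_of_mem d (prod_slot_mem_multidegreePart hdeg f), apply_ite concat, map_zero,
    concat_prod_slot]

end Multidegree

/-! ### The action of `B_ν` on polynomials -/

section Action

variable {A : Type*} {n : ℕ}

theorem isHomog_iff_mem_supported {d : ℕ} {x : NCPoly A} :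
    IsHomog d x ↔ x ∈ MonoidAlgebra.supported ℚ ℚ {w : FreeMonoid A | w.length = d} := by
  simp [IsHomog, MonoidAlgebra.mem_supported, Set.subset_def]

theorem isHomog_single (w : FreeMonoid A) (r : ℚ) :
    IsHomog w.length (MonoidAlgebra.single w r : NCPoly A) := by
  classical
  intro v hv
  rw [MonoidAlgebra.coeff_single, Finsupp.single_apply] at hv
  rw [(ite_ne_right_iff.mp hv).1]

theorem prod_ofFn_single_of {k : ℕ} (a : Fin k → A) :
    (List.ofFn fun j => (MonoidAlgebra.single (FreeMonoid.of (a j)) 1 : NCPoly A)).prod =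
      MonoidAlgebra.single (FreeMonoid.ofList (List.ofFn a)) 1 := by
  rw [prod_ofFn_single, ← Function.comp_def FreeMonoid.of, ← List.map_ofFn,
    ← FreeMonoid.lift_ofList]
  exact congrArg (MonoidAlgebra.single · 1)
    (DFunLike.congr_fun (FreeMonoid.lift_restrict (MonoidHom.id _)) _)

theorem wordAct_ofFn (a : Fin n → A) (σ : Equiv.Perm (Fin n)) :
    wordAct n (FreeMonoid.ofList (List.ofFn a)) σ =
      MonoidAlgebra.single (FreeMonoid.ofList (List.ofFn (a ∘ σ))) 1 := by
  rw [wordAct, dif_pos (by simp)]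
  congr 3
  funext i
  exact List.get_ofFn a _

theorem wordAct_of_length_ne {w : FreeMonoid A} (hw : w.length ≠ n) (σ : Equiv.Perm (Fin n)) :
    wordAct n w σ = 0 :=
  dif_neg hw

theorem polyAct_sum_single (x : NCPoly A) (s : Finset (Equiv.Perm (Fin n))) :
    polyAct x (∑ σ ∈ s, MonoidAlgebra.single σ 1) =
      Finsupp.linearCombination ℚ (fun w => ∑ σ ∈ s, wordAct n w σ) x.coeff := by
  rw [polyAct, Finsupp.linearCombination_apply]
  refine Finsupp.sum_congr fun w _ => ?_
  rw [MonoidAlgebra.coeff_sum, ← Finsupp.sum_finsetSum_index (by simp)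
    (fun σ b c => by rw [mul_add, add_smul]), Finset.smul_sum]
  simp

open Classical in
theorem sum_wordAct_ofFn (ν : Composition n) (a : Fin n → A) :
    ∑ σ : Equiv.Perm (Fin n) with
        σ ∈ minLeftCosetReps (simpleSet n) (simpleSet n \ simpleSubset ν),
      wordAct n (FreeMonoid.ofList (List.ofFn a)) σ =
    ∑ f : Fin n → Fin ν.length with fiberSum 1 f = ν.blocksFun,
      MonoidAlgebra.single (FreeMonoid.ofList (List.ofFn (a ∘ Tuple.sort f))) 1 := by
  simp only [mem_minLeftCosetReps_iff_sort_eq, wordAct_ofFn]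
  refine Finset.sum_bij' (fun σ _ => ν.index ∘ σ.symm) (fun f _ => Tuple.sort f) ?_ ?_ ?_ ?_ ?_
  · intro σ _
    simpa [← fiberSum_one_index, Pi.one_comp] using
      fiberSum_comp_equiv (1 : Fin n → ℕ) ν.index σ.symm
  · intro f hf
    rw [← comp_sort_eq_index (Finset.mem_filter.mp hf).2]
    simp [Function.comp_assoc]
  · intro σ hσ
    exact (Finset.mem_filter.mp hσ).2
  · intro f hf
    rw [← comp_sort_eq_index (Finset.mem_filter.mp hf).2]
    simp [Function.comp_assoc]
  · intro σ hσ
    rw [(Finset.mem_filter.mp hσ).2]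

open Classical in
theorem sum_wordAct (ν : Composition n) (w : FreeMonoid A) :
    ∑ σ : Equiv.Perm (Fin n) with
        σ ∈ minLeftCosetReps (simpleSet n) (simpleSet n \ simpleSubset ν), wordAct n w σ =
      concat (degProj ν.blocksFun (coprod (MonoidAlgebra.single w 1))) := by
  obtain ⟨N, a, rfl⟩ : ∃ (N : ℕ) (a : Fin N → A), w = FreeMonoid.ofList (List.ofFn a) :=
    ⟨w.length, w.toList.get, (List.ofFn_get w.toList).symm⟩
  rw [← prod_ofFn_single_of, concat_degProj_coprod_prod_ofFn (e := 1) (fun j => coprod_letter _)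
    (fun j => isHomog_iff_mem_supported.mp (isHomog_single _ 1))]
  by_cases hN : N = n
  · subst hN
    rw [sum_wordAct_ofFn]
    exact Finset.sum_congr rfl fun f _ => (prod_ofFn_single_of (a ∘ Tuple.sort f)).symm
  · have hlen : (FreeMonoid.ofList (List.ofFn a)).length ≠ n := by
      simpa [FreeMonoid.length] using hN
    rw [Finset.sum_eq_zero fun σ _ => wordAct_of_length_ne hlen σ,
      Finset.sum_eq_zero fun f hf => ?_]
    have hsum := sum_fiberSum (1 : Fin N → ℕ) f
    rw [(Finset.mem_filter.mp hf).2, ν.sum_blocksFun] at hsum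
    exact absurd (by simpa using hsum.symm) hN

theorem polyAct_descentBasis (ν : Composition n) (x : NCPoly A) :
    polyAct x (descentBasis ν) = concat (degProj ν.blocksFun (coprod x)) := by
  classical
  rw [descentBasis, polyAct_sum_single]
  suffices h : Finsupp.linearCombination ℚ _ ∘ₗ
      (MonoidAlgebra.coeffLinearEquiv ℚ).toLinearMap =
      concat ∘ₗ degProj ν.blocksFun ∘ₗ coprod.toLinearMap from LinearMap.congr_fun h x
  refine (MonoidAlgebra.basis (FreeMonoid A) ℚ).ext fun w => ?_
  simp [MonoidAlgebra.basis_apply, sum_wordAct]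

theorem polyAct_prod_descentBasis {κ : Composition n} (ν : Composition n)
    {P : Fin κ.length → NCPoly A} (hP : IsLieFamily κ P) :
    polyAct (List.ofFn P).prod (descentBasis ν) =
      ∑ f : Fin κ.length → Fin ν.length with fiberSum κ.blocksFun f = ν.blocksFun,
        (List.ofFn (P ∘ Tuple.sort f)).prod := by
  rw [polyAct_descentBasis, concat_degProj_coprod_prod_ofFn
    (fun j => freeLie_le_primitivePart (hP j).1)
    (fun j => isHomog_iff_mem_supported.mp (hP j).2)]

end Action

/-! ### The matrices -/

section Matrices

variable {k m : ℕ} {e : Fin k → ℕ}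

/-- The matrix whose only nonzero entry in column `j` is `e j`, in row `f j`. -/
def cellMatrix (e : Fin k → ℕ) (f : Fin k → Fin m) : Matrix (Fin m) (Fin k) ℕ :=
  fun i j => if f j = i then e j else 0

theorem cellMatrix_injective (he : ∀ j, e j ≠ 0) :
    Function.Injective (cellMatrix (m := m) e) := by
  intro f g h
  ext1 j
  have hj := congrFun₂ h (f j) j
  by_contra hne
  simp [cellMatrix, Ne.symm hne, he j] at hj

theorem nonzeroCells_cellMatrix (he : ∀ j, e j ≠ 0) (f : Fin k → Fin m) :
    nonzeroCells (cellMatrix e f) = List.ofFn fun j => (f (Tuple.sort f j), Tuple.sort f j) := by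
  have hrow (i : Fin m) :
      ((List.finRange k).filter fun j => cellMatrix e f i j ≠ 0).map (fun j => (i, j)) =
        ((List.finRange k).filter fun j => f j = i).map fun j => (f j, j) := by
    simp only [cellMatrix, ne_eq, ite_eq_right_iff, he, imp_false, not_not]
    exact List.map_congr_left fun j hj => by rw [of_decide_eq_true (List.mem_filter.mp hj).2]
  simp_rw [nonzeroCells, hrow, ← List.map_flatMap, flatMap_filter_eq_ofFn_sort, List.map_ofFn,
    Function.comp_def]

theorem rowReading_cellMatrix (he : ∀ j, e j ≠ 0) (f : Fin k → Fin m) :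
    rowReading (cellMatrix e f) = List.ofFn (e ∘ Tuple.sort f) := by
  rw [rowReading, nonzeroCells_cellMatrix he, List.map_ofFn]
  simp [Function.comp_def, cellMatrix]

theorem rowProduct_cellMatrix {A : Type*} (he : ∀ j, e j ≠ 0) (f : Fin k → Fin m)
    (P : Fin k → NCPoly A) :
    rowProduct P (cellMatrix e f) = (List.ofFn (P ∘ Tuple.sort f)).prod := by
  rw [rowProduct, nonzeroCells_cellMatrix he, List.map_ofFn]
  rfl

theorem exists_eq_cellMatrix_of_existsUnique_ne_zero {z : Matrix (Fin m) (Fin k) ℕ}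
    (hcol : ∀ j, ∑ i, z i j = e j) (huniq : ∀ j, ∃! i, z i j ≠ 0) :
    ∃ f : Fin k → Fin m, cellMatrix e f = z := by
  choose f _ huniq using huniq
  have hzero {i : Fin m} {j : Fin k} (hi : f j ≠ i) : z i j = 0 :=
    by_contra fun hne => hi (huniq j i hne).symm
  refine ⟨f, ?_⟩
  ext i j
  rw [cellMatrix]
  split_ifs with hi
  · rw [← hcol j, ← hi, Fintype.sum_eq_single (f j) fun i hi => hzero hi.symm]
  · exact (hzero hi).symm

theorem sum_cellMatrix_row (e : Fin k → ℕ) (f : Fin k → Fin m) (i : Fin m) :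
    ∑ j, cellMatrix e f i j = fiberSum e f i :=
  (Finset.sum_filter _ _).symm

theorem blocksFun_ne_zero {n : ℕ} (κ : Composition n) (j : Fin κ.length) : κ.blocksFun j ≠ 0 :=
  Nat.one_le_iff_ne_zero.mp (κ.one_le_blocksFun j)

theorem actionMatrices_eq_image {n : ℕ} (κ ν : Composition n) :
    actionMatrices κ ν =
      cellMatrix κ.blocksFun '' {f | fiberSum κ.blocksFun f = ν.blocksFun} := by
  ext z
  constructor
  · rintro ⟨hcol, hrow, huniq⟩
    obtain ⟨f, rfl⟩ := exists_eq_cellMatrix_of_existsUnique_ne_zero hcol huniq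
    exact ⟨f, funext fun i => (sum_cellMatrix_row _ f i).symm.trans (hrow i), rfl⟩
  · rintro ⟨f, hf, rfl⟩
    refine ⟨fun j => by simp [cellMatrix], fun i => ?_, fun j => ⟨f j, ?_, fun i hi => ?_⟩⟩
    · rw [sum_cellMatrix_row, hf]
    · simpa [cellMatrix] using blocksFun_ne_zero κ j
    · exact by_contra fun hne => hi (if_neg (Ne.symm hne))

theorem sum_actionMatrices {n : ℕ} {B : Type*} [AddCommMonoid B] (κ ν : Composition n)
    (F : Matrix (Fin ν.length) (Fin κ.length) ℕ → B) :
    ∑ z ∈ (actionMatrices_finite κ ν).toFinset, F z =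
      ∑ f : Fin κ.length → Fin ν.length with fiberSum κ.blocksFun f = ν.blocksFun,
        F (cellMatrix κ.blocksFun f) := by
  classical
  rw [← Finset.sum_image (cellMatrix_injective (blocksFun_ne_zero κ)).injOn]
  congr 1
  rw [← Finset.coe_inj]
  simp [actionMatrices_eq_image]

theorem exists_composition_isLieMonomial_comp_perm {A : Type*} {n : ℕ} {κ : Composition n}
    {P : Fin κ.length → NCPoly A} (hP : IsLieFamily κ P) (σ : Equiv.Perm (Fin κ.length)) :
    ∃ c : Composition n, c.blocks = List.ofFn (κ.blocksFun ∘ σ) ∧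
      IsLieMonomial c (List.ofFn (P ∘ σ)).prod := by
  have hperm : (List.ofFn (κ.blocksFun ∘ σ)).Perm κ.blocks :=
    κ.ofFn_blocksFun ▸ σ.ofFn_comp_perm κ.blocksFun
  let c : Composition n :=
    { blocks := List.ofFn (κ.blocksFun ∘ σ)
      blocks_pos := fun hi => κ.blocks_pos (hperm.mem_iff.mp hi)
      blocks_sum := hperm.sum_eq.trans κ.blocks_sum }
  have hlen : c.length = κ.length := List.length_ofFn
  refine ⟨c, rfl, P ∘ σ ∘ Fin.cast hlen, fun j => ⟨(hP _).1, ?_⟩, ?_⟩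
  · have hblock : c.blocksFun j = κ.blocksFun (σ (j.cast hlen)) := List.getElem_ofFn _
    exact hblock ▸ (hP _).2
  · exact congrArg List.prod (List.ofFn_congr hlen.symm _)

theorem adjacentSums_ofFn_comp_sort (e : Fin k → ℕ) (f : Fin k → Fin m) :
    AdjacentSums (List.ofFn (e ∘ Tuple.sort f)) (List.ofFn (fiberSum e f)) := by
  refine ⟨(List.finRange m).map fun i => ((List.finRange k).filter fun j => f j = i).map e, ?_, ?_⟩
  · rw [← List.flatMap_def, ← List.map_flatMap, flatMap_filter_eq_ofFn_sort, List.map_ofFn]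
  · rw [List.map_map, List.ofFn_eq_map]
    refine List.map_congr_left fun i _ => ?_
    rw [fiberSum, Function.comp_apply, ← List.sum_toFinset e ((List.nodup_finRange k).filter _)]
    congr 1
    ext j
    simp

end Matrices

end DescentAlgebra

end

theorem mainTheorem5 {A : Type*} (n : ℕ) (κ ν : Composition n)
    (P : Fin κ.length → DescentAlgebra.NCPoly A) (hP : DescentAlgebra.IsLieFamily κ P) :
    (DescentAlgebra.polyAct (List.ofFn P).prod (DescentAlgebra.descentBasis ν) =
      ∑ z ∈ (DescentAlgebra.actionMatrices_finite κ ν).toFinset,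
        DescentAlgebra.rowProduct P z) ∧
    (∀ z ∈ DescentAlgebra.actionMatrices κ ν, ∃ c : Composition n,
      c.blocks = DescentAlgebra.rowReading z ∧
        DescentAlgebra.IsLieMonomial c (DescentAlgebra.rowProduct P z)) ∧
    ((¬ ∃ l : List ℕ, l.Perm κ.blocks ∧ DescentAlgebra.AdjacentSums l ν.blocks) →
      DescentAlgebra.polyAct (List.ofFn P).prod (DescentAlgebra.descentBasis ν) = 0) := by
  open DescentAlgebra in
  have hκ := blocksFun_ne_zero κ
  refine ⟨?_, ?_, fun hno => ?_⟩
  · rw [polyAct_prod_descentBasis ν hP, sum_actionMatrices]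
    simp only [rowProduct_cellMatrix hκ]
  · rw [actionMatrices_eq_image]
    rintro _ ⟨f, -, rfl⟩
    rw [rowReading_cellMatrix hκ, rowProduct_cellMatrix hκ]
    exact exists_composition_isLieMonomial_comp_perm hP (Tuple.sort f)
  · rw [polyAct_prod_descentBasis ν hP]
    refine Finset.sum_eq_zero fun f hf => absurd ?_ hno
    refine ⟨List.ofFn (κ.blocksFun ∘ Tuple.sort f), ?_, ?_⟩
    · exact κ.ofFn_blocksFun ▸ (Tuple.sort f).ofFn_comp_perm κ.blocksFun
    · rw [← ν.ofFn_blocksFun, ← (Finset.mem_filter.mp hf).2]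
      exact adjacentSums_ofFn_comp_sort κ.blocksFun f
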